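/- All linkages consist of finitely many directed paths in a digraph $G$. A \emph{half-integral linkage} is a finite set $\mathcal{L}$ of directed paths of $G$ such that every vertex of $G$ lies on at most two paths of $\mathcal{L}$, no two distinct paths of $\mathcal{L}$ have the same starting vertex, and no two have the same ending vertex; $A(\mathcal{L})$ and $B(\mathcal{L})$ denote its sets of starting and of ending vertices (so $|A(\mathcal{L})|=|B(\mathcal{L})|=|\mathcal{L}|$). Two linkages $\mathcal{L},\mathcal{L}'$ are \emph{dual} to each other if $A(\mathcal{L})=B(\mathcal{L}')$ and $A(\mathcal{L}')=B(\mathcal{L})$. The \emph{intersection graph} $I(\mathcal{L},\mathcal{K})$ is the bipartite graph with classes $\mathcal{L}$ and $\mathcal{K}$ in which $L\in\mathcal{L}$ and $K\in\mathcal{K}$ are adjacent if they share a vertex. The \emph{directed treewidth} of a finite digraph $H$ is the least $w\ge 0$ for which there are a finite arborescence $R$, bags $\beta(t)\subseteq V(H)$ for the nodes $t$ of $R$ that partition $V(H)$ (bags may be empty), and guards $\gamma(e)\subseteq V(H)$ for the arcs $e$ of $R$ such that (i) for every arc $e=(s,t)$ of $R$, no closed directed walk of $H-\gamma(e)$ contains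 both a vertex of $S_e$ and a vertex of $V(H)\setminus S_e$, where $S_e$ is the union of the bags of the nodes in the subtree rooted at $t$; and (ii) $\bigl|\beta(t)\cup\bigcup_{e\ni t}\gamma(e)\bigr|\le w+1$ for every node $t$. \textbf{Lemma.} Let $k,d$ be positive integers and let $\mathcal{P},\mathcal{P}^{\mathrm{back}},\mathcal{Q},\mathcal{Q}^{\mathrm{back}}$ be four half-integral linkages in a digraph such that $\mathcal{P}$ and $\mathcal{P}^{\mathrm{back}}$ are dual to each other and $\mathcal{Q}$ and $\mathcal{Q}^{\mathrm{back}}$ are dual to each other. Assume $|\mathcal{P}|\ge 24k$, and let the intersection graph $I(\mathcal{P},\mathcal{Q})$ have minimum degree at least $d$, where $$d\;\ge\; 8k\,\log_{4/3}\!\left(\frac{|\mathcal{P}|}{24k}\right)+24k+4 .$$ Then the digraph $\bigcup(\mathcal{P}\cup\mathcal{P}^{\mathrm{back}}\cup\mathcal{Q}\cup\mathcal{Q}^{\mathrm{back}})$, formed by all vertices and arcs of these paths, has directed treewidth at least $k$. -/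

import Mathlib

namespace HalfIntegralLinkage

/-! ### Walks and paths in digraphs -/

/-- The nonempty vertex sequence `l` is a directed walk of `G`. -/
def IsWalk {V : Type*} (G : Digraph V) (l : List V) : Prop :=
  l ≠ [] ∧ l.IsChain G.Adj

/-- A directed path: a directed walk without repeated vertices
(a single vertex is a path of length zero). -/
structure DiPath {V : Type*} (G : Digraph V) where
  verts : List V
  isWalk : IsWalk G verts
  nodup : verts.Nodup

namespace DiPath

/-- The starting vertex of a path. -/
def start {V : Type*} {G : Digraph V} (p : DiPath G) : V := p.verts.head p.isWalk.1

/-- The ending vertex of a path. -/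
def finish {V : Type*} {G : Digraph V} (p : DiPath G) : V := p.verts.getLast p.isWalk.1

end DiPath

/-! ### Linkages -/

/-- The set `A(L)` of starting vertices of the paths in `L`. -/
def linkFrom {V : Type*} {G : Digraph V} (L : Finset (DiPath G)) : Set V :=
  DiPath.start '' (L : Set (DiPath G))

/-- The set `B(L)` of ending vertices of the paths in `L`. -/
def linkTo {V : Type*} {G : Digraph V} (L : Finset (DiPath G)) : Set V :=
  DiPath.finish '' (L : Set (DiPath G))

open Classical in
/-- `L` has congestion `c`: every vertex is visited at most `c` times in total. -/
def HasCongestion {V : Type*} {G : Digraph V} (c : ℕ) (L : Finset (DiPath G)) : Prop :=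
  ∀ v : V, ∑ p ∈ L, p.verts.count v ≤ c

/-- A half-integral linkage: a finite set of paths of congestion `2` which links the set
`A(L)` bijectively to the set `B(L)`, so that `|A(L)| = |B(L)| = |L|`. -/
structure IsHalfIntegralLinkage {V : Type*} {G : Digraph V} (L : Finset (DiPath G)) : Prop where
  start_injOn : Set.InjOn DiPath.start (L : Set (DiPath G))
  finish_injOn : Set.InjOn DiPath.finish (L : Set (DiPath G))
  congestion : HasCongestion 2 L

/-- Two linkages are dual to each other. -/
def AreDual {V : Type*} {G : Digraph V} (L L' : Finset (DiPath G)) : Prop :=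
  linkFrom L = linkTo L' ∧ linkFrom L' = linkTo L

/-- The intersection graph `I(L, K)`: the bipartite graph whose two classes are (copies of) `L`
and `K`, with an edge whenever the two paths share a vertex. -/
def intersectionGraph {V : Type*} {G : Digraph V} (L K : Finset (DiPath G)) :
    SimpleGraph ({p // p ∈ L} ⊕ {q // q ∈ K}) :=
  SimpleGraph.fromRel fun x y =>
    ∃ (p : {p // p ∈ L}) (q : {q // q ∈ K}), x = Sum.inl p ∧ y = Sum.inr q ∧
      ∃ v, v ∈ p.1.verts ∧ v ∈ q.1.verts

/-- The union of the paths in `F`: its vertices are the vertices of the paths in `F`, and its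
arcs are the pairs of consecutive vertices of paths in `F`. -/
def pathUnion {V : Type*} {G : Digraph V} (F : Set (DiPath G)) :
    Digraph {v : V // ∃ p ∈ F, v ∈ p.verts} where
  Adj u v := ∃ p ∈ F, [u.1, v.1] <:+: p.verts

/-! ### Directed treewidth -/

/-- A finite arborescence on the node set `T`, given by its root and its parent function.
Its arcs are the pairs `(parent t, t)` with `t ≠ root`. -/
structure Arborescence (T : Type*) where
  root : T
  parent : T → T
  parent_root : parent root = root
  reaches_root : ∀ t, ∃ n : ℕ, parent^[n] t = root

/-- `R.Below t s`: the node `s` lies in the subtree rooted at `t` (possibly `s = t`). -/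
def Arborescence.Below {T : Type*} (R : Arborescence T) (t s : T) : Prop :=
  ∃ n : ℕ, R.parent^[n] s = t

/-- A directed tree decomposition of `G` over an arborescence with node set `T`.
The bags partition the vertex set (bags may be empty). `guard t` is the guard `γ(e)` of the arc
`e = (parent t, t)`, and is used only for `t ≠ root`. The guard of `e` separates the union `S` of
the bags below `e` from its complement: no closed directed walk of `G - γ(e)` meets both.
(This holds in particular if `S` is `γ(e)`-normal.) -/
structure DirTreeDecomp {V : Type*} (G : Digraph V) (T : Type*) extends Arborescence T where
  bag : T → Set V
  guard : T → Set V
  bag_partition : ∀ v : V, ∃! t : T, v ∈ bag t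
  guarded : ∀ t : T, t ≠ root → ∀ (l : List V) (hl : IsWalk G l),
    l.head hl.1 = l.getLast hl.1 → (∀ v ∈ l, v ∉ guard t) →
    ∀ u ∈ l, ∀ v ∈ l, (∃ s, toArborescence.Below t s ∧ u ∈ bag s) →
      ∃ s, toArborescence.Below t s ∧ v ∈ bag s

/-- The set `Γ(t)`: the bag of `t` together with the guards of all arcs incident with `t`. -/
def DirTreeDecomp.fullBag {V : Type*} {G : Digraph V} {T : Type*} (D : DirTreeDecomp G T)
    (t : T) : Set V :=
  D.bag t ∪ {v | ∃ s, s ≠ D.root ∧ (s = t ∨ D.parent s = t) ∧ v ∈ D.guard s}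

/-- `G` has a directed tree decomposition of width at most `w`. -/
def HasDirTreeDecomp {V : Type*} (G : Digraph V) (w : ℕ) : Prop :=
  ∃ (n : ℕ) (D : DirTreeDecomp G (Fin (n + 1))), ∀ t, (D.fullBag t).encard ≤ w + 1

/-- The directed treewidth of a finite digraph: the least width of a directed tree
decomposition, where the width is the maximum of `|Γ(t)| - 1`. -/
noncomputable def directedTreewidth {V : Type*} (G : Digraph V) : ℕ :=
  sInf {w | HasDirTreeDecomp G w}

/-- Every finite digraph has a directed tree decomposition, so that the infimum above is
attained. -/
theorem exists_hasDirTreeDecomp {V : Type*} [Finite V] (G : Digraph V) :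
    ∃ w, HasDirTreeDecomp G w := by
  have hsub : Subsingleton (Fin (0 + 1)) := inferInstanceAs (Subsingleton (Fin 1))
  refine ⟨Nat.card V, 0,
    { root := 0
      parent := id
      parent_root := rfl
      reaches_root := fun t => ⟨0, Subsingleton.elim _ _⟩
      bag := fun _ => Set.univ
      guard := fun _ => ∅
      bag_partition := fun v => ⟨0, trivial, fun _ _ => Subsingleton.elim _ _⟩
      guarded := fun t ht => absurd (Subsingleton.elim _ _) ht }, fun t => ?_⟩
  refine (Set.encard_le_encard (Set.subset_univ _)).trans ?_
  rw [Set.encard_univ, ENat.card_eq_coe_natCard]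
  exact le_self_add

end HalfIntegralLinkage

/-!
Suppose that the directed treewidth is less than `k`. For every subfamily `M` of `P`, a deepest node
of an optimal tree decomposition with more than half of `M` in its subtree has a full bag `X` of at
most `k` vertices such that each strong component of `G - X` contains at most half of the paths of
`M`. Along a chain of sets that no arc of `G - X` enters, growing by one strong component at a time,
one therefore finds a set `S` that contains a positive proportion, but at most three quarters, of
`M`, where `S` or its complement is entered by no arc of `G - X`. By duality as many paths of `P`
and its dual leave such a set as enter it, and those that enter meet `X`; so at most `6k` paths of
`P`, and likewise of `Q`, cross the cut. Keeping only the paths within `S` lowers the minimum degree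
of the intersection graph by at most `6k` while `M` shrinks by a factor `3 / 4`. After about
`log_{4/3} (|P| / 24k)` rounds the minimum degree would exceed the number of paths left.
-/

namespace HalfIntegralLinkage

/-! ### Strong sets and closed sets of a digraph -/

section Digraph

variable {V : Type*} {H : Digraph V} {X C D : Set V}

/-- The digraph `H - X`. The vertices of `X` are kept as isolated vertices, so that the vertex
type does not change. -/
def deleteVerts (H : Digraph V) (X : Set V) : Digraph V where
  Adj u v := H.Adj u v ∧ u ∉ X ∧ v ∉ X

/-- The vertices of `C` lie in a common strong component of `H`. -/
def IsStrong (H : Digraph V) (C : Set V) : Prop :=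
  ∀ u ∈ C, ∀ v ∈ C, Relation.ReflTransGen H.Adj u v

/-- No arc of `H` enters `D`: every in-neighbour of a vertex of `D` belongs to `D`. -/
def PredClosed (H : Digraph V) (D : Set V) : Prop :=
  ∀ u v, H.Adj u v → v ∈ D → u ∈ D

theorem predClosed_deleteVerts_compl (H : Digraph V) (X : Set V) :
    PredClosed (deleteVerts H X) Xᶜ :=
  fun _ _ huv _ => huv.2.1

theorem PredClosed.forall_mem_of_getLast_mem (hD : PredClosed H D) {l : List V}
    (hl : IsWalk H l) (h : l.getLast hl.1 ∈ D) : ∀ v ∈ l, v ∈ D :=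
  hl.2.backwards_induction (· ∈ D) l (fun {u v} huv hv => hD u v huv hv) fun _ => h

theorem PredClosed.forall_notMem_of_head_notMem (hD : PredClosed H D) {l : List V}
    (hl : IsWalk H l) (h : l.head hl.1 ∉ D) : ∀ v ∈ l, v ∉ D :=
  hl.2.induction (· ∉ D) l (fun {u v} huv hu hv => hu (hD u v huv hv)) fun _ => h

theorem IsWalk.of_deleteVerts {l : List V} (hl : IsWalk (deleteVerts H X) l) : IsWalk H l :=
  ⟨hl.1, hl.2.imp fun _ _ h => h.1⟩

theorem IsWalk.deleteVerts_of_forall_notMem {l : List V} (hl : IsWalk H l) (hX : ∀ v ∈ l, v ∉ X) :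
    IsWalk (deleteVerts H X) l := by
  refine ⟨hl.1, List.isChain_iff_forall_rel_of_append_cons_cons.2 fun {a b l₁ l₂} h => ?_⟩
  exact ⟨List.isChain_iff_forall_rel_of_append_cons_cons.1 hl.2 h, hX a (by simp [h]),
    hX b (by simp [h])⟩

theorem IsWalk.forall_notMem_of_head_notMem {l : List V} (hl : IsWalk (deleteVerts H X) l)
    (h : l.head hl.1 ∉ X) : ∀ v ∈ l, v ∉ X :=
  hl.2.induction (· ∉ X) l (fun {_ _} huv _ => huv.2.2) fun _ => h

theorem IsWalk.exists_extension {l : List V} (hl : IsWalk H l) {w : V}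
    (hw : Relation.ReflTransGen H.Adj (l.getLast hl.1) w) :
    ∃ (l' : List V) (hl' : IsWalk H l'), l <+: l' ∧ l'.getLast hl'.1 = w := by
  induction hw with
  | refl => exact ⟨l, hl, List.prefix_rfl, rfl⟩
  | @tail a b _ hab ih =>
    obtain ⟨l', hl', hll', hlast⟩ := ih
    refine ⟨l' ++ [b], ⟨by simp, hl'.2.append (List.isChain_singleton b) ?_⟩,
      hll'.trans (List.prefix_append _ _), by simp⟩
    simp [List.getLast?_eq_getLast_of_ne_nil hl'.1, hlast, hab]

theorem IsStrong.exists_closed_walk (hC : IsStrong H C) {u v : V} (hu : u ∈ C) (hv : v ∈ C) :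
    ∃ (l : List V) (hl : IsWalk H l), l.head hl.1 = u ∧ l.getLast hl.1 = u ∧ v ∈ l := by
  have hsingle : IsWalk H [u] := ⟨by simp, List.isChain_singleton u⟩
  obtain ⟨l₁, hl₁, hul₁, rfl⟩ := hsingle.exists_extension (hC u hu v hv)
  obtain ⟨l₂, hl₂, hl₁₂, hlast⟩ := hl₁.exists_extension (hC _ hv u hu)
  exact ⟨l₂, hl₂, ((hul₁.trans hl₁₂).head (by simp)).symm, hlast,
    hl₁₂.subset (List.getLast_mem hl₁.1)⟩

/-- Between a maximal closed set with property `p` and a minimal closed proper superset there is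
room for one strong component only. -/
theorem exists_predClosed_ssubset_isStrong_diff {U : Set V} (hUfin : U.Finite)
    (hU : PredClosed H U) {p : Set V → Prop} (hempty : p ∅) (hpU : ¬ p U) :
    ∃ D E, D ⊆ E ∧ E ⊆ U ∧ PredClosed H D ∧ PredClosed H E ∧ p D ∧ ¬ p E ∧
      IsStrong H (E \ D) := by
  obtain ⟨D, hDmax⟩ := (hUfin.finite_subsets.subset fun D hD => hD.1 :
      {D | D ⊆ U ∧ PredClosed H D ∧ p D}.Finite).exists_maximal
    ⟨∅, Set.empty_subset U, fun _ _ _ h => h.elim, hempty⟩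
  obtain ⟨hDU, hD, hpD⟩ := hDmax.prop
  obtain ⟨E, hEmin⟩ := (hUfin.finite_subsets.subset fun E hE => hE.1 :
      {E | E ⊆ U ∧ PredClosed H E ∧ D ⊂ E}.Finite).exists_minimal
    ⟨U, subset_rfl, hU, hDU.ssubset_of_ne fun h => hpU (h ▸ hpD)⟩
  obtain ⟨hEU, hE, hDE⟩ := hEmin.prop
  refine ⟨D, E, hDE.subset, hEU, hD, hE, hpD,
    fun hpE => hDE.not_subset (hDmax.le_of_ge ⟨hEU, hE, hpE⟩ hDE.subset), ?_⟩
  intro u hu v hv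
  set reaching := D ∪ {w ∈ E | Relation.ReflTransGen H.Adj w v}
  have hreaching : PredClosed H reaching := by
    rintro x w hxw (hw | ⟨hwE, hwv⟩)
    · exact Or.inl (hD x w hxw hw)
    · exact Or.inr ⟨hE x w hxw hwE, hwv.head hxw⟩
  have hsub : reaching ⊆ E := Set.union_subset hDE.subset fun w hw => hw.1
  have hproper : D ⊂ reaching :=
    ⟨Set.subset_union_left, fun h => hv.2 (h (Or.inr ⟨hv.1, .refl⟩))⟩
  have hle : E ⊆ reaching := hEmin.le_of_le ⟨hsub.trans hEU, hreaching, hproper⟩ hsub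
  exact ((hle hu.1).resolve_left hu.2).2

end Digraph

/-! ### Supermodular weights and balanced cuts -/

section Weight

variable {V : Type*} {H : Digraph V} {μ : Set V → ℕ}

/-- A supermodular set function with `μ ∅ = 0`; the example of interest counts the paths of a
family that lie within a set. -/
structure IsSupermodular (μ : Set V → ℕ) : Prop where
  empty : μ ∅ = 0
  add_le : ∀ A B, μ A + μ B ≤ μ (A ∪ B) + μ (A ∩ B)

theorem IsSupermodular.add_le_of_disjoint (hμ : IsSupermodular μ) {A B : Set V}
    (h : Disjoint A B) : μ A + μ B ≤ μ (A ∪ B) := by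
  simpa [h.inter_eq, hμ.empty] using hμ.add_le A B

theorem IsSupermodular.mono (hμ : IsSupermodular μ) : Monotone μ := fun A B hAB => by
  have h := hμ.add_le_of_disjoint (Set.disjoint_sdiff_right (s := A) (t := B))
  rw [Set.union_sdiff_cancel hAB] at h
  exact (Nat.le_add_right _ _).trans h

/-- In a chain of closed sets refining the order of the strong components, look at the first
step `D ⊂ E` at which the weight reaches a quarter. As `E \ D` has at most half of the weight, `E`
and the complement of `D` cannot both exceed three quarters. -/
theorem exists_balanced_cut [Finite V] (hμ : IsSupermodular μ) {X : Set V} {b : ℕ}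
    (hX : μ .univ ≤ μ Xᶜ + b)
    (hcut : ∀ D, PredClosed (deleteVerts H X) D → μ .univ ≤ μ D + μ Dᶜ + b)
    (hb : 2 * b < μ .univ)
    (hstrong : ∀ C, IsStrong (deleteVerts H X) C → Disjoint C X → 2 * μ C ≤ μ .univ) :
    ∃ S, (PredClosed (deleteVerts H X) S ∨ PredClosed (deleteVerts H X) Sᶜ) ∧
      0 < μ S ∧ 4 * μ S ≤ 3 * μ .univ := by
  obtain ⟨D, E, hDE, hEX, hD, hE, hDlight, hEheavy, hED⟩ :=
    exists_predClosed_ssubset_isStrong_diff (Set.toFinite Xᶜ)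
      (predClosed_deleteVerts_compl H X) (p := fun A => 4 * μ A < μ .univ)
      (by have := hμ.empty; omega) (by omega)
  by_cases hbalanced : 4 * μ E ≤ 3 * μ .univ
  · exact ⟨E, Or.inl hE, by omega, hbalanced⟩
  · have hcomp : 2 * μ (E \ D) ≤ μ .univ :=
      hstrong _ hED (Set.disjoint_left.2 fun v hv => hEX hv.1)
    have huniv : E ∪ Dᶜ = .univ := by
      rw [Set.union_comm, ← Set.compl_subset_iff_union, compl_compl]
      exact hDE
    have hsuper : μ E + μ Dᶜ ≤ μ .univ + μ (E \ D) := by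
      simpa [huniv, Set.sdiff_eq] using hμ.add_le E Dᶜ
    have := hcut D hD
    exact ⟨Dᶜ, Or.inr (by rwa [compl_compl]), by omega, by omega⟩

end Weight

/-! ### Balanced nodes of directed tree decompositions -/

section TreeDecomposition

variable {T : Type*}

namespace Arborescence

variable {R : Arborescence T}

theorem Below.eq_or_exists_child {t s : T} (h : R.Below t s) :
    s = t ∨ ∃ c, c ≠ R.root ∧ R.parent c = t ∧ R.Below c s := by
  obtain ⟨n, hn⟩ := h
  induction n with
  | zero => exact Or.inl hn
  | succ n ih =>
    rw [Function.iterate_succ_apply'] at hn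
    by_cases hroot : R.parent^[n] s = R.root
    · exact ih (by rw [hroot, ← hn, hroot, R.parent_root])
    · exact Or.inr ⟨_, hroot, hn, n, rfl⟩

open Classical in
/-- The distance of a node from the root. -/
noncomputable def depth (R : Arborescence T) (t : T) : ℕ := Nat.find (R.reaches_root t)

theorem depth_parent_lt {t : T} (ht : t ≠ R.root) : R.depth (R.parent t) < R.depth t := by
  classical
  have hspec : R.parent^[R.depth t] t = R.root := Nat.find_spec (R.reaches_root t)
  obtain ⟨n, hn⟩ : ∃ n, R.depth t = n + 1 :=
    Nat.exists_eq_succ_of_ne_zero fun h => ht (by simpa [h] using hspec)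
  rw [hn, Function.iterate_succ_apply] at hspec
  rw [hn, Nat.lt_succ_iff]
  exact Nat.find_min' _ hspec

end Arborescence

namespace DirTreeDecomp

variable {V : Type*} {H : Digraph V} (D : DirTreeDecomp H T) {t : T} {C : Set V}

/-- The union of the bags of the nodes in the subtree rooted at `t`; this is the set `S_e` of the
arc `e` with head `t`. -/
def subtreeVerts (t : T) : Set V := {v | ∃ s, D.Below t s ∧ v ∈ D.bag s}

theorem subtreeVerts_root : D.subtreeVerts D.root = .univ :=
  Set.eq_univ_of_forall fun v =>
    let ⟨s, hs, _⟩ := D.bag_partition v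
    ⟨s, D.reaches_root s, hs⟩

/-- A closed walk through `v ∈ C` and any other vertex of `C` avoids the guard of the arc to the
child of `t` above `v`, so it cannot leave the subtree of this child. -/
theorem exists_child_subset_subtreeVerts (hC : IsStrong (deleteVerts H (D.fullBag t)) C)
    (hCt : Disjoint C (D.fullBag t)) {v : V} (hvC : v ∈ C) (hvt : v ∈ D.subtreeVerts t) :
    ∃ c, c ≠ D.root ∧ D.parent c = t ∧ C ⊆ D.subtreeVerts c := by
  have hv : v ∉ D.fullBag t := Set.disjoint_left.1 hCt hvC
  obtain ⟨s, hts, hvs⟩ := hvt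
  obtain rfl | ⟨c, hc, rfl, hcs⟩ := hts.eq_or_exists_child
  · exact absurd (Or.inl hvs) hv
  refine ⟨c, hc, rfl, fun w hw => ?_⟩
  obtain ⟨l, hl, hhead, hlast, hwl⟩ := hC.exists_closed_walk hvC hw
  have havoid := hl.forall_notMem_of_head_notMem (hhead ▸ hv)
  exact D.guarded c hc l hl.of_deleteVerts (hhead.trans hlast.symm)
    (fun x hx hxc => havoid x hx (Or.inr ⟨c, hc, Or.inr rfl, hxc⟩))
    v (hhead ▸ List.head_mem hl.1) w hwl ⟨s, hcs, hvs⟩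

/-- A deepest node with more than half of the weight in its subtree does it. -/
theorem exists_balanced_fullBag [Finite T] {μ : Set V → ℕ} (hμ : IsSupermodular μ) :
    ∃ t, ∀ C, IsStrong (deleteVerts H (D.fullBag t)) C → Disjoint C (D.fullBag t) →
      2 * μ C ≤ μ .univ := by
  rcases Nat.eq_zero_or_pos (μ .univ) with hzero | hpos
  · refine ⟨D.root, fun C _ _ => ?_⟩
    have := hμ.mono (Set.subset_univ C)
    omega
  obtain ⟨t, ht, htmax⟩ := (Set.toFinite {t | μ .univ < 2 * μ (D.subtreeVerts t)}).exists_maximalFor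
    D.depth _ ⟨D.root, by simp only [Set.mem_ofPred_eq, subtreeVerts_root]; omega⟩
  rw [Set.mem_ofPred_eq] at ht
  refine ⟨t, fun C hC hCt => ?_⟩
  by_cases hmeet : Disjoint C (D.subtreeVerts t)
  · have := hμ.add_le_of_disjoint hmeet
    have := hμ.mono (Set.subset_univ (C ∪ D.subtreeVerts t))
    omega
  · obtain ⟨v, hvC, hvt⟩ := Set.not_disjoint_iff.1 hmeet
    obtain ⟨c, hc, rfl, hCc⟩ := D.exists_child_subset_subtreeVerts hC hCt hvC hvt
    have hchild : 2 * μ (D.subtreeVerts c) ≤ μ .univ := by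
      by_contra! hheavy
      have hdepth := D.toArborescence.depth_parent_lt hc
      exact hdepth.not_ge (htmax hheavy hdepth.le)
    exact (Nat.mul_le_mul_left 2 (hμ.mono hCc)).trans hchild

end DirTreeDecomp

end TreeDecomposition

/-! ### Families of paths -/

namespace DiPath

variable {V : Type*} {G : Digraph V}

/-- The set of vertices of a path. -/
def vertexSet (p : DiPath G) : Set V := {v | v ∈ p.verts}

theorem start_mem_vertexSet (p : DiPath G) : p.start ∈ p.vertexSet := List.head_mem _

end DiPath

section PathFamilies

variable {V : Type*} {G : Digraph V} {L L' M N : Finset (DiPath G)} {X D S : Set V}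

open Classical in
/-- The paths of `L` all of whose vertices lie in `S`. -/
noncomputable def pathsWithin (L : Finset (DiPath G)) (S : Set V) : Finset (DiPath G) :=
  {p ∈ L | p.vertexSet ⊆ S}

open Classical in
/-- The paths of `L` that have a vertex in `X`. -/
noncomputable def pathsMeeting (L : Finset (DiPath G)) (X : Set V) : Finset (DiPath G) :=
  {p ∈ L | (p.vertexSet ∩ X).Nonempty}

open Classical in
/-- The paths of `L` that have vertices on both sides of the cut `(S, Sᶜ)`. -/
noncomputable def pathsCrossing (L : Finset (DiPath G)) (S : Set V) : Finset (DiPath G) :=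
  {p ∈ L | (p.vertexSet ∩ S).Nonempty ∧ (p.vertexSet ∩ Sᶜ).Nonempty}

open Classical in
/-- The paths of `L` that start in `D` and end outside `D`. -/
noncomputable def pathsLeaving (L : Finset (DiPath G)) (D : Set V) : Finset (DiPath G) :=
  {p ∈ L | p.start ∈ D ∧ p.finish ∉ D}

theorem pathsWithin_univ (L : Finset (DiPath G)) : pathsWithin L .univ = L := by
  simp [pathsWithin]

theorem pathsWithin_subset (L : Finset (DiPath G)) (S : Set V) : pathsWithin L S ⊆ L := by
  classical exact Finset.filter_subset _ _

theorem pathsMeeting_mono (h : L ⊆ L') (X : Set V) : pathsMeeting L X ⊆ pathsMeeting L' X := by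
  classical exact Finset.filter_subset_filter _ h

theorem pathsCrossing_compl (L : Finset (DiPath G)) (S : Set V) :
    pathsCrossing L Sᶜ = pathsCrossing L S := by
  classical exact Finset.filter_congr fun p _ => by rw [compl_compl, and_comm]

theorem pathsCrossing_mono (h : L ⊆ L') (S : Set V) : pathsCrossing L S ⊆ pathsCrossing L' S := by
  classical exact Finset.filter_subset_filter _ h

theorem card_pathsWithin_compl_add_card_pathsMeeting (L : Finset (DiPath G)) (X : Set V) :
    (pathsWithin L Xᶜ).card + (pathsMeeting L X).card = L.card := by
  classical
  simp only [pathsWithin, pathsMeeting, Set.subset_compl_iff_disjoint_right,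
    ← Set.not_disjoint_iff_nonempty_inter]
  exact Finset.card_filter_add_card_filter_not _

theorem card_le_card_pathsWithin_add_card_pathsCrossing (L : Finset (DiPath G)) (S : Set V) :
    L.card ≤ (pathsWithin L S).card + (pathsWithin L Sᶜ).card + (pathsCrossing L S).card := by
  classical
  have hcover : L ⊆ pathsWithin L S ∪ pathsWithin L Sᶜ ∪ pathsCrossing L S := fun p hp => by
    simp only [pathsWithin, pathsCrossing, Finset.mem_union, Finset.mem_filter, hp, true_and,
      ← Set.not_disjoint_iff_nonempty_inter, Set.disjoint_compl_right_iff_subset,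
      Set.subset_compl_iff_disjoint_right]
    tauto
  exact (Finset.card_le_card hcover).trans ((Finset.card_union_le _ _).trans
    (Nat.add_le_add_right (Finset.card_union_le _ _) _))

theorem isSupermodular_card_pathsWithin (L : Finset (DiPath G)) :
    IsSupermodular fun S => (pathsWithin L S).card where
  empty := by
    simp only [pathsWithin, Set.subset_empty_iff, Finset.card_eq_zero, Finset.filter_eq_empty_iff]
    exact fun p _ hp => (hp ▸ p.start_mem_vertexSet :)
  add_le A B := by
    classical
    rw [← Finset.card_union_add_card_inter]
    refine Nat.add_le_add (Finset.card_le_card ?_) (Finset.card_le_card ?_)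
    · refine Finset.union_subset ?_ ?_ <;>
        refine Finset.monotone_filter_right _ fun p _ hp => hp.trans ?_
      exacts [Set.subset_union_left, Set.subset_union_right]
    · rw [pathsWithin, pathsWithin, ← Finset.filter_and]
      exact Finset.monotone_filter_right _ fun p _ hp => Set.subset_inter hp.1 hp.2

theorem card_pathsMeeting_le {c k : ℕ} (hL : HasCongestion c L) (hX : X.encard ≤ k) :
    (pathsMeeting L X).card ≤ c * k := by
  classical
  obtain ⟨X, rfl⟩ := (Set.finite_of_encard_le_coe hX).exists_finset_coe
  rw [Set.encard_coe_eq_coe_finsetCard, Nat.cast_le] at hX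
  have hthrough (v : V) : (L.filter fun p => v ∈ p.verts).card ≤ c := by
    refine le_trans ?_ (hL v)
    rw [Finset.card_filter]
    refine Finset.sum_le_sum fun p _ => ?_
    split_ifs with hv
    · convert List.one_le_count_iff.2 hv
    · exact Nat.zero_le _
  have hcover : pathsMeeting L X ⊆ X.biUnion fun v => L.filter fun p => v ∈ p.verts := by
    intro p hp
    obtain ⟨hpL, v, hvp, hvX⟩ := Finset.mem_filter.1 hp
    exact Finset.mem_biUnion.2 ⟨v, hvX, Finset.mem_filter.2 ⟨hpL, hvp⟩⟩
  calc (pathsMeeting L X).card ≤ X.card * c :=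
        (Finset.card_le_card hcover).trans
          (Finset.card_biUnion_le_card_mul _ _ _ fun v _ => hthrough v)
    _ ≤ c * k := by rw [mul_comm]; exact Nat.mul_le_mul_left c hX

end PathFamilies

/-! ### Dual linkages and directed cuts -/

section DualLinkages

variable {V : Type*} {G : Digraph V} {L L' : Finset (DiPath G)} {X D S : Set V} {k : ℕ}

open Classical in
theorem card_filter_mem_eq_ncard_image_inter {α β : Type*} {f : α → β} {s : Finset α}
    (hf : Set.InjOn f s) (B : Set β) : {a ∈ s | f a ∈ B}.card = (f '' s ∩ B).ncard := by
  rw [← Set.image_inter_preimage, (hf.mono Set.inter_subset_left).ncard_image,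
    ← Set.ncard_coe_finset, Finset.coe_filter]
  rfl

theorem card_pathsLeaving_add_card_pathsLeaving (hL : IsHalfIntegralLinkage L)
    (hL' : IsHalfIntegralLinkage L') (hdual : AreDual L L') (D : Set V) :
    (pathsLeaving L D).card + (pathsLeaving L' D).card =
      (pathsLeaving L Dᶜ).card + (pathsLeaving L' Dᶜ).card := by
  classical
  have hbalance (K : Finset (DiPath G)) :
      {p ∈ K | p.start ∈ D}.card + (pathsLeaving K Dᶜ).card =
        {p ∈ K | p.finish ∈ D}.card + (pathsLeaving K D).card := by
    simp only [pathsLeaving, Finset.card_filter, ← Finset.sum_add_distrib]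
    refine Finset.sum_congr rfl fun p _ => ?_
    by_cases p.start ∈ D <;> by_cases p.finish ∈ D <;> simp [*]
  have hstart : {p ∈ L | p.start ∈ D}.card = {p ∈ L' | p.finish ∈ D}.card := by
    rw [card_filter_mem_eq_ncard_image_inter hL.start_injOn,
      card_filter_mem_eq_ncard_image_inter hL'.finish_injOn]
    exact congrArg (fun A => (A ∩ D).ncard) hdual.1
  have hfinish : {p ∈ L' | p.start ∈ D}.card = {p ∈ L | p.finish ∈ D}.card := by
    rw [card_filter_mem_eq_ncard_image_inter hL'.start_injOn,
      card_filter_mem_eq_ncard_image_inter hL.finish_injOn]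
    exact congrArg (fun A => (A ∩ D).ncard) hdual.2
  have := hbalance L
  have := hbalance L'
  omega

theorem pathsLeaving_compl_subset_pathsMeeting (hD : PredClosed (deleteVerts G X) D)
    (L : Finset (DiPath G)) : pathsLeaving L Dᶜ ⊆ pathsMeeting L X := by
  classical
  intro p hp
  simp only [pathsLeaving, pathsMeeting, Finset.mem_filter] at hp ⊢
  obtain ⟨hpL, hstart, hfinish⟩ := hp
  refine ⟨hpL, ?_⟩
  by_contra hX
  have hwalk := p.isWalk.deleteVerts_of_forall_notMem fun v hv hvX => hX ⟨v, hv, hvX⟩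
  exact hstart (hD.forall_mem_of_getLast_mem hwalk (not_not.1 hfinish) _ p.start_mem_vertexSet)

theorem card_pathsCrossing_le_card_pathsMeeting_add (hD : PredClosed (deleteVerts G X) D)
    (L : Finset (DiPath G)) :
    (pathsCrossing L D).card ≤ (pathsMeeting L X).card + (pathsLeaving L D).card := by
  classical
  have hcover : pathsCrossing L D ⊆ pathsMeeting L X ∪ pathsLeaving L D := by
    intro p hp
    obtain ⟨hpL, ⟨v, hvp, hvD⟩, w, hwp, hwD⟩ := Finset.mem_filter.1 hp
    rw [Finset.mem_union, pathsMeeting, Finset.mem_filter, pathsLeaving, Finset.mem_filter]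
    refine or_iff_not_imp_left.2 fun hX => ⟨hpL, ?_⟩
    have hwalk := p.isWalk.deleteVerts_of_forall_notMem fun v hv hvX => hX ⟨hpL, v, hv, hvX⟩
    exact ⟨not_not.1 fun h => hD.forall_notMem_of_head_notMem hwalk h v hvp hvD,
      fun h => hwD (hD.forall_mem_of_getLast_mem hwalk h w hwp)⟩
  exact (Finset.card_le_card hcover).trans (Finset.card_union_le _ _)

/-- By duality, as many paths of `L ∪ L'` leave a closed set as enter it, and a path can
only enter it through `X`. -/
theorem card_pathsCrossing_le (hL : IsHalfIntegralLinkage L) (hL' : IsHalfIntegralLinkage L')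
    (hdual : AreDual L L') (hX : X.encard ≤ k)
    (hS : PredClosed (deleteVerts G X) S ∨ PredClosed (deleteVerts G X) Sᶜ) :
    (pathsCrossing L S).card ≤ 6 * k := by
  wlog hS' : PredClosed (deleteVerts G X) S generalizing S
  · rw [← pathsCrossing_compl]
    exact this (by rwa [compl_compl, or_comm]) (hS.resolve_left hS')
  have := card_pathsLeaving_add_card_pathsLeaving hL hL' hdual S
  have := Finset.card_le_card (pathsLeaving_compl_subset_pathsMeeting hS' L)
  have := Finset.card_le_card (pathsLeaving_compl_subset_pathsMeeting hS' L')
  have := card_pathsCrossing_le_card_pathsMeeting_add hS' L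
  have := card_pathsMeeting_le hL.congestion hX
  have := card_pathsMeeting_le hL'.congestion hX
  omega

theorem exists_balanced_cut_of_fullBag_encard_le [Finite V] {T : Type*} [Finite T]
    (R : DirTreeDecomp G T) (hR : ∀ t, (R.fullBag t).encard ≤ k) {P P' Q Q' : Finset (DiPath G)}
    (hP : IsHalfIntegralLinkage P) (hP' : IsHalfIntegralLinkage P') (hPdual : AreDual P P')
    (hQ : IsHalfIntegralLinkage Q) (hQ' : IsHalfIntegralLinkage Q') (hQdual : AreDual Q Q')
    {M : Finset (DiPath G)} (hMP : M ⊆ P) (hM : 12 * k < M.card) :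
    ∃ S, (pathsCrossing P S).card ≤ 6 * k ∧ (pathsCrossing Q S).card ≤ 6 * k ∧
      0 < (pathsWithin M S).card ∧ 4 * (pathsWithin M S).card ≤ 3 * M.card := by
  have hμ := isSupermodular_card_pathsWithin M
  obtain ⟨t, ht⟩ := R.exists_balanced_fullBag hμ
  have hmeet : M.card ≤ (pathsWithin M (R.fullBag t)ᶜ).card + 6 * k := by
    have := card_pathsWithin_compl_add_card_pathsMeeting M (R.fullBag t)
    have := Finset.card_le_card (pathsMeeting_mono hMP (R.fullBag t))
    have := card_pathsMeeting_le hP.congestion (hR t)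
    omega
  have hcut (D : Set V) (hD : PredClosed (deleteVerts G (R.fullBag t)) D) :
      M.card ≤ (pathsWithin M D).card + (pathsWithin M Dᶜ).card + 6 * k := by
    have := card_le_card_pathsWithin_add_card_pathsCrossing M D
    have := Finset.card_le_card (pathsCrossing_mono hMP D)
    have := card_pathsCrossing_le hP hP' hPdual (hR t) (Or.inl hD)
    omega
  obtain ⟨S, hS, hpos, hbalanced⟩ := exists_balanced_cut (b := 6 * k) hμ
    (by simpa only [pathsWithin_univ] using hmeet) (by simpa only [pathsWithin_univ] using hcut)
    (by simp only [pathsWithin_univ]; omega) ht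
  rw [pathsWithin_univ] at hbalanced
  exact ⟨S, card_pathsCrossing_le hP hP' hPdual (hR t) hS,
    card_pathsCrossing_le hQ hQ' hQdual (hR t) hS, hpos, hbalanced⟩

end DualLinkages

/-! ### The degree bound -/

section DegreeThreshold

/-- The degree `c * log_{4/3} (x / 3c) + 3c` which the intersection graph of two families cannot
exceed if the first one has `x` paths and its subfamilies have balanced cuts crossed by at most
`c` paths. -/
noncomputable def degreeThreshold (c x : ℝ) : ℝ := c * Real.logb (4 / 3) (x / (3 * c)) + 3 * c

variable {c x y : ℝ}

theorem degreeThreshold_mono (hc : 0 < c) (hx : 0 < x) (hxy : x ≤ y) :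
    degreeThreshold c x ≤ degreeThreshold c y := by
  unfold degreeThreshold
  gcongr
  norm_num

theorem degreeThreshold_three_quarters_mul (hc : 0 < c) (hx : 0 < x) :
    degreeThreshold c (3 / 4 * x) = degreeThreshold c x - c := by
  have hdiv : 3 / 4 * x / (3 * c) = x / (3 * c) / (4 / 3) := by ring
  rw [degreeThreshold, degreeThreshold, hdiv, Real.logb_div (by positivity) (by norm_num),
    Real.logb_self_eq_one (by norm_num)]
  ring

theorem degreeThreshold_four_mul (hc : 0 < c) : degreeThreshold c (4 * c) = 4 * c := by
  have hdiv : 4 * c / (3 * c) = 4 / 3 := by field_simp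
  rw [degreeThreshold, hdiv, Real.logb_self_eq_one (by norm_num)]
  ring

/-- Bernoulli's inequality for the exponent `3 (x - 1) ≤ 1`, that is, concavity of the
logarithm between its values at `1` and `4 / 3`. -/
theorem three_mul_sub_one_le_logb (h₁ : 1 ≤ x) (h₂ : x ≤ 4 / 3) :
    3 * (x - 1) ≤ Real.logb (4 / 3) x := by
  rw [Real.le_logb_iff_rpow_le (by norm_num) (by linarith)]
  calc (4 / 3 : ℝ) ^ (3 * (x - 1)) = (1 + 1 / 3) ^ (3 * (x - 1)) := by norm_num
    _ ≤ 1 + 3 * (x - 1) * (1 / 3) :=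
        rpow_one_add_le_one_add_mul_self (by norm_num) (by linarith) (by linarith)
    _ = x := by ring

theorem le_degreeThreshold (hc : 0 < c) (h₁ : 3 * c ≤ x) (h₂ : x ≤ 4 * c) :
    x ≤ degreeThreshold c x := by
  have hlog := three_mul_sub_one_le_logb ((one_le_div (by positivity)).2 h₁)
    ((div_le_iff₀ (by positivity)).2 (by linarith : x ≤ 4 / 3 * (3 * c)))
  calc x = c * (3 * (x / (3 * c) - 1)) + 3 * c := by field_simp; ring
    _ ≤ degreeThreshold c x := by unfold degreeThreshold; gcongr

end DegreeThreshold

section DenselyIntersecting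

variable {V : Type*} {G : Digraph V} {P Q M N : Finset (DiPath G)} {S : Set V} {c d : ℕ}

/-- Every path of `M` meets at least `d` paths of `N` and vice versa, that is, the minimum degree
of the intersection graph of `M` and `N` is at least `d` (if it has a vertex). -/
structure DenselyIntersecting (d : ℕ) (M N : Finset (DiPath G)) : Prop where
  left : ∀ p ∈ M, d ≤ (pathsMeeting N p.vertexSet).card
  right : ∀ q ∈ N, d ≤ (pathsMeeting M q.vertexSet).card

theorem DenselyIntersecting.mono {d' : ℕ} (h : DenselyIntersecting d M N) (hd : d' ≤ d) :
    DenselyIntersecting d' M N :=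
  ⟨fun p hp => hd.trans (h.left p hp), fun q hq => hd.trans (h.right q hq)⟩

theorem DenselyIntersecting.le_card_left (h : DenselyIntersecting d M N) (hM : M.Nonempty) :
    d ≤ M.card := by
  classical
  rcases Nat.eq_zero_or_pos d with rfl | hd
  · exact Nat.zero_le _
  obtain ⟨p, hp⟩ := hM
  obtain ⟨q, hq⟩ := Finset.card_pos.1 (hd.trans_le (h.left p hp))
  exact (h.right q (Finset.filter_subset _ _ hq)).trans
    (Finset.card_le_card (Finset.filter_subset _ _))

theorem card_pathsMeeting_le_pathsWithin_add_pathsCrossing {X : Set V} (hX : X ⊆ S)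
    (L : Finset (DiPath G)) :
    (pathsMeeting L X).card ≤ (pathsMeeting (pathsWithin L S) X).card +
      (pathsCrossing L S).card := by
  classical
  refine (Finset.card_le_card fun q hq => ?_).trans (Finset.card_union_le _ _)
  obtain ⟨hqL, hqX⟩ := Finset.mem_filter.1 hq
  by_cases hqS : q.vertexSet ⊆ S
  · exact Finset.mem_union_left _
      (Finset.mem_filter.2 ⟨Finset.mem_filter.2 ⟨hqL, hqS⟩, hqX⟩)
  · exact Finset.mem_union_right _ (Finset.mem_filter.2
      ⟨hqL, hqX.mono (Set.inter_subset_inter_right _ hX), Set.inter_compl_nonempty_iff.2 hqS⟩)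

theorem DenselyIntersecting.restrict (h : DenselyIntersecting d M N)
    (hM : (pathsCrossing M S).card ≤ c) (hN : (pathsCrossing N S).card ≤ c) :
    DenselyIntersecting (d - c) (pathsWithin M S) (pathsWithin N S) := by
  classical
  constructor
  · intro p hp
    obtain ⟨hpM, hpS⟩ := Finset.mem_filter.1 hp
    have := h.left p hpM
    have := card_pathsMeeting_le_pathsWithin_add_pathsCrossing hpS N
    omega
  · intro q hq
    obtain ⟨hqN, hqS⟩ := Finset.mem_filter.1 hq
    have := h.right q hqN
    have := card_pathsMeeting_le_pathsWithin_add_pathsCrossing hqS M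
    omega

/-- Passing to the paths on one side of a balanced cut lowers the degree by at most `c` and the
threshold by at least `c`. Once at most `4c` paths are left, the degree is bounded by their
number. -/
theorem DenselyIntersecting.cast_le_degreeThreshold (hc : 0 < c)
    (hcut : ∀ M ⊆ P, 4 * c < M.card → ∃ S, (pathsCrossing P S).card ≤ c ∧
      (pathsCrossing Q S).card ≤ c ∧ 0 < (pathsWithin M S).card ∧
      4 * (pathsWithin M S).card ≤ 3 * M.card)
    (hMP : M ⊆ P) (hNQ : N ⊆ Q) (h : DenselyIntersecting d M N) (hM : 3 * c ≤ M.card) :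
    (d : ℝ) ≤ degreeThreshold c M.card := by
  induction hn : M.card using Nat.strong_induction_on generalizing M N d with
  | _ n ih =>
  subst hn
  have hcR : (0 : ℝ) < c := by exact_mod_cast hc
  rcases le_or_gt M.card (4 * c) with hsmall | hlarge
  · have hdM : d ≤ M.card := h.le_card_left (Finset.card_pos.1 (by omega))
    calc (d : ℝ) ≤ M.card := by exact_mod_cast hdM
      _ ≤ degreeThreshold c M.card :=
          le_degreeThreshold hcR (by exact_mod_cast hM)
            (by exact_mod_cast hsmall)
  · obtain ⟨S, hPS, hQS, hpos, hbalanced⟩ := hcut M hMP hlarge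
    have h' := h.restrict ((Finset.card_le_card (pathsCrossing_mono hMP S)).trans hPS)
      ((Finset.card_le_card (pathsCrossing_mono hNQ S)).trans hQS)
    have hMR : 4 * (c : ℝ) ≤ M.card := by exact_mod_cast hlarge.le
    have hd : (d : ℝ) ≤ (d - c : ℕ) + c := by exact_mod_cast le_tsub_add
    rcases lt_or_ge (pathsWithin M S).card (3 * c) with htiny | hM'
    · have hdc : d ≤ 4 * c := by
        have := h'.le_card_left (Finset.card_pos.1 hpos)
        omega
      calc (d : ℝ) ≤ 4 * c := by exact_mod_cast hdc
        _ = degreeThreshold c (4 * c) := (degreeThreshold_four_mul hcR).symm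
        _ ≤ degreeThreshold c M.card := degreeThreshold_mono hcR (by positivity) hMR
    · have hbalancedR : ((pathsWithin M S).card : ℝ) ≤ 3 / 4 * M.card := by
        have : 4 * ((pathsWithin M S).card : ℝ) ≤ 3 * M.card := by exact_mod_cast hbalanced
        linarith
      have hih := ih (pathsWithin M S).card (by omega) ((pathsWithin_subset M S).trans hMP)
        ((pathsWithin_subset N S).trans hNQ) h' hM' rfl
      calc (d : ℝ) ≤ (d - c : ℕ) + c := hd
        _ ≤ degreeThreshold c (3 / 4 * M.card) + c := by
            gcongr
            exact hih.trans (degreeThreshold_mono hcR (by exact_mod_cast hpos) hbalancedR)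
        _ = degreeThreshold c M.card := by
            rw [degreeThreshold_three_quarters_mul hcR (by linarith), sub_add_cancel]

end DenselyIntersecting

/-! ### Intersection graphs -/

section IntersectionGraph

variable {V : Type*} {G : Digraph V} {L K : Finset (DiPath G)}

theorem intersectionGraph_adj_inl_inr {p : {p // p ∈ L}} {q : {q // q ∈ K}} :
    (intersectionGraph L K).Adj (.inl p) (.inr q) ↔ (q.1.vertexSet ∩ p.1.vertexSet).Nonempty := by
  simp [intersectionGraph, Set.Nonempty, DiPath.vertexSet, and_comm]

theorem intersectionGraph_not_adj_inl_inl {p p' : {p // p ∈ L}} :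
    ¬ (intersectionGraph L K).Adj (.inl p) (.inl p') := by
  simp [intersectionGraph]

theorem intersectionGraph_not_adj_inr_inr {q q' : {q // q ∈ K}} :
    ¬ (intersectionGraph L K).Adj (.inr q) (.inr q') := by
  simp [intersectionGraph]

theorem intersectionGraph_adj_inr_inl {p : {p // p ∈ L}} {q : {q // q ∈ K}} :
    (intersectionGraph L K).Adj (.inr q) (.inl p) ↔ (p.1.vertexSet ∩ q.1.vertexSet).Nonempty := by
  rw [SimpleGraph.adj_comm, intersectionGraph_adj_inl_inr, Set.inter_comm]

open Classical in
theorem degree_intersectionGraph_inl (p : {p // p ∈ L}) :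
    (intersectionGraph L K).degree (.inl p) = (pathsMeeting K p.1.vertexSet).card := by
  rw [← SimpleGraph.card_neighborFinset_eq_degree, SimpleGraph.neighborFinset_eq_filter,
    Finset.card_filter, Fintype.sum_sum_type, pathsMeeting, Finset.card_filter,
    ← Finset.sum_attach K]
  simp only [intersectionGraph_not_adj_inl_inl, intersectionGraph_adj_inl_inr, if_false,
    Finset.sum_const_zero, zero_add, Finset.univ_eq_attach]

open Classical in
theorem degree_intersectionGraph_inr (q : {q // q ∈ K}) :
    (intersectionGraph L K).degree (.inr q) = (pathsMeeting L q.1.vertexSet).card := by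
  rw [← SimpleGraph.card_neighborFinset_eq_degree, SimpleGraph.neighborFinset_eq_filter,
    Finset.card_filter, Fintype.sum_sum_type, pathsMeeting, Finset.card_filter,
    ← Finset.sum_attach L]
  simp only [intersectionGraph_not_adj_inr_inr, intersectionGraph_adj_inr_inl, if_false,
    Finset.sum_const_zero, add_zero, Finset.univ_eq_attach]

open Classical in
theorem denselyIntersecting_minDegree (L K : Finset (DiPath G)) :
    DenselyIntersecting (intersectionGraph L K).minDegree L K where
  left p hp := degree_intersectionGraph_inl ⟨p, hp⟩ ▸ SimpleGraph.minDegree_le_degree _ _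
  right q hq := degree_intersectionGraph_inr ⟨q, hq⟩ ▸ SimpleGraph.minDegree_le_degree _ _

end IntersectionGraph

/-! ### The treewidth bound -/

section Treewidth

variable {V : Type*} {G : Digraph V} {P P' Q Q' : Finset (DiPath G)} {k c d : ℕ}

theorem le_directedTreewidth_of_denselyIntersecting [Finite V] (hP : IsHalfIntegralLinkage P)
    (hP' : IsHalfIntegralLinkage P') (hQ : IsHalfIntegralLinkage Q)
    (hQ' : IsHalfIntegralLinkage Q') (hPdual : AreDual P P') (hQdual : AreDual Q Q')
    (hPQ : DenselyIntersecting d P Q) (hkc : 6 * k ≤ c) (hcard : 3 * c ≤ P.card)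
    (hd : degreeThreshold c P.card < d) : k ≤ directedTreewidth G := by
  by_contra! hwidth
  obtain ⟨n, R, hR⟩ := Nat.sInf_mem (exists_hasDirTreeDecomp G)
  have hbag (t) : (R.fullBag t).encard ≤ k := (hR t).trans (by exact_mod_cast hwidth)
  refine hd.not_ge (hPQ.cast_le_degreeThreshold (by omega) (fun M hMP hM => ?_) subset_rfl
    subset_rfl hcard)
  obtain ⟨S, hPS, hQS, hbalanced⟩ := exists_balanced_cut_of_fullBag_encard_le R hbag
    hP hP' hPdual hQ hQ' hQdual hMP (by omega)
  exact ⟨S, hPS.trans hkc, hQS.trans hkc, hbalanced⟩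

end Treewidth

/-! ### Paths of a union of paths -/

section Map

variable {V W : Type*} {G : Digraph V} {H : Digraph W} (f : W ↪ V)
  (hf : ∀ u v, H.Adj u v → G.Adj (f u) (f v)) {L L' : Finset (DiPath H)} {d : ℕ}

namespace DiPath

theorem verts_injective : Function.Injective (verts : DiPath G → List V) := by
  rintro ⟨l, hl, hnodup⟩ ⟨l', hl', hnodup'⟩ rfl
  rfl

/-- The image of a path under an injective homomorphism of digraphs. -/
def map : DiPath H ↪ DiPath G where
  toFun p :=
    { verts := p.verts.map f
      isWalk := ⟨by simpa using p.isWalk.1, List.isChain_map_of_isChain f hf p.isWalk.2⟩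
      nodup := p.nodup.map f.injective }
  inj' _ _ h := verts_injective (List.map_injective_iff.2 f.injective (congrArg verts h))

theorem verts_map (p : DiPath H) : (map f hf p).verts = p.verts.map f := rfl

theorem start_map (p : DiPath H) : (map f hf p).start = f p.start := List.head_map _

theorem finish_map (p : DiPath H) : (map f hf p).finish = f p.finish := List.getLast_map _

theorem vertexSet_map (p : DiPath H) : (map f hf p).vertexSet = f '' p.vertexSet :=
  Set.ext fun _ => List.mem_map

end DiPath

theorem linkFrom_map : linkFrom (L.map (DiPath.map f hf)) = f '' linkFrom L := by
  simp only [linkFrom, Finset.coe_map, Set.image_image, DiPath.start_map]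

theorem linkTo_map : linkTo (L.map (DiPath.map f hf)) = f '' linkTo L := by
  simp only [linkTo, Finset.coe_map, Set.image_image, DiPath.finish_map]

theorem pathsMeeting_map (X : Set W) :
    pathsMeeting (L.map (DiPath.map f hf)) (f '' X) =
      (pathsMeeting L X).map (DiPath.map f hf) := by
  classical
  simp only [pathsMeeting, Finset.filter_map, Function.comp_def, DiPath.vertexSet_map,
    ← Set.image_inter f.injective, Set.image_nonempty]

variable {f hf}

theorem AreDual.of_map (h : AreDual (L.map (DiPath.map f hf)) (L'.map (DiPath.map f hf))) :
    AreDual L L' := by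
  simpa only [AreDual, linkFrom_map, linkTo_map, f.injective.image_injective.eq_iff] using h

theorem HasCongestion.of_map (h : HasCongestion d (L.map (DiPath.map f hf))) :
    HasCongestion d L := fun v => by
  classical
  simpa only [Finset.sum_map, DiPath.verts_map, List.count_map_of_injective _ f f.injective] using
    h (f v)

theorem IsHalfIntegralLinkage.of_map (h : IsHalfIntegralLinkage (L.map (DiPath.map f hf))) :
    IsHalfIntegralLinkage L where
  start_injOn p hp q hq hpq := (DiPath.map f hf).injective <|
    h.start_injOn (Finset.mem_map_of_mem _ hp) (Finset.mem_map_of_mem _ hq)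
      (by rw [DiPath.start_map, DiPath.start_map, hpq])
  finish_injOn p hp q hq hpq := (DiPath.map f hf).injective <|
    h.finish_injOn (Finset.mem_map_of_mem _ hp) (Finset.mem_map_of_mem _ hq)
      (by rw [DiPath.finish_map, DiPath.finish_map, hpq])
  congestion := h.congestion.of_map

theorem DenselyIntersecting.of_map
    (h : DenselyIntersecting d (L.map (DiPath.map f hf)) (L'.map (DiPath.map f hf))) :
    DenselyIntersecting d L L' where
  left p hp := by
    simpa only [DiPath.vertexSet_map, pathsMeeting_map, Finset.card_map] using
      h.left _ (Finset.mem_map_of_mem _ hp)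
  right q hq := by
    simpa only [DiPath.vertexSet_map, pathsMeeting_map, Finset.card_map] using
      h.right _ (Finset.mem_map_of_mem _ hq)

end Map

section PathUnion

variable {V : Type*} {G : Digraph V} {F : Set (DiPath G)}

theorem adj_of_pathUnion_adj (u v : {v : V // ∃ p ∈ F, v ∈ p.verts})
    (h : (pathUnion F).Adj u v) : G.Adj u v :=
  let ⟨p, _, huv⟩ := h
  List.isChain_pair.1 (p.isWalk.2.infix huv)

/-- A path of the union of the paths in `F`, regarded as a path of `G`. -/
def DiPath.ofPathUnion : DiPath (pathUnion F) ↪ DiPath G :=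
  DiPath.map (Function.Embedding.subtype _) adj_of_pathUnion_adj

theorem DiPath.exists_ofPathUnion_eq {p : DiPath G} (hp : p ∈ F) :
    ∃ p₀ : DiPath (pathUnion F), ofPathUnion p₀ = p := by
  have hverts : ∀ v ∈ p.verts, ∃ q ∈ F, v ∈ q.verts := fun v hv => ⟨p, hp, hv⟩
  set l := p.verts.attachWith _ hverts
  have hl : l.map Subtype.val = p.verts := List.attachWith_map_subtype_val hverts
  have hchain : l.IsChain (pathUnion F).Adj :=
    List.isChain_iff_forall_rel_of_append_cons_cons.2 fun {u v l₁ l₂} h =>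
      ⟨p, hp, l₁.map Subtype.val, l₂.map Subtype.val, by rw [← hl, h]; simp⟩
  refine ⟨⟨l, ⟨fun h => p.isWalk.1 (by rw [← hl, h, List.map_nil]), hchain⟩, ?_⟩,
    verts_injective hl⟩
  exact List.Nodup.of_map Subtype.val (hl ▸ p.nodup)

theorem exists_map_ofPathUnion_eq {L : Finset (DiPath G)} (hL : (L : Set (DiPath G)) ⊆ F) :
    ∃ L₀ : Finset (DiPath (pathUnion F)), L₀.map DiPath.ofPathUnion = L := by
  classical
  have hrange : (L : Set (DiPath G)) ⊆ DiPath.ofPathUnion (F := F) '' .univ := fun p hp =>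
    Set.image_univ ▸ DiPath.exists_ofPathUnion_eq (hL hp)
  obtain ⟨L₀, -, hL₀⟩ := Finset.subset_set_image_iff.1 hrange
  exact ⟨L₀, (Finset.map_eq_image _ _).trans hL₀⟩

theorem finite_vertices_pathUnion (hF : F.Finite) : Finite {v : V // ∃ p ∈ F, v ∈ p.verts} := by
  refine ((hF.biUnion fun p _ => p.verts.finite_toSet).subset ?_).to_subtype
  rintro v ⟨p, hp, hv⟩
  exact Set.mem_biUnion hp hv

theorem le_directedTreewidth_pathUnion {P P' Q Q' : Finset (DiPath G)} {k c d : ℕ}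
    (hF : F.Finite) (hPF : ↑P ⊆ F) (hPF' : ↑P' ⊆ F) (hQF : ↑Q ⊆ F) (hQF' : ↑Q' ⊆ F)
    (hP : IsHalfIntegralLinkage P) (hP' : IsHalfIntegralLinkage P')
    (hQ : IsHalfIntegralLinkage Q) (hQ' : IsHalfIntegralLinkage Q')
    (hPdual : AreDual P P') (hQdual : AreDual Q Q') (hPQ : DenselyIntersecting d P Q)
    (hkc : 6 * k ≤ c) (hcard : 3 * c ≤ P.card) (hd : degreeThreshold c P.card < d) :
    k ≤ directedTreewidth (pathUnion F) := by
  have := finite_vertices_pathUnion hF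
  obtain ⟨P, rfl⟩ := exists_map_ofPathUnion_eq hPF
  obtain ⟨P', rfl⟩ := exists_map_ofPathUnion_eq hPF'
  obtain ⟨Q, rfl⟩ := exists_map_ofPathUnion_eq hQF
  obtain ⟨Q', rfl⟩ := exists_map_ofPathUnion_eq hQF'
  rw [Finset.card_map] at hcard hd
  exact le_directedTreewidth_of_denselyIntersecting hP.of_map hP'.of_map hQ.of_map hQ'.of_map
    hPdual.of_map hQdual.of_map hPQ.of_map hkc hcard hd

end PathUnion

end HalfIntegralLinkage

open HalfIntegralLinkage in
open Classical in
theorem mainTheorem4 {V : Type*} (G : Digraph V) (k d : ℕ) (hk : 0 < k)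
    (P Pback Q Qback : Finset (DiPath G))
    (hP : IsHalfIntegralLinkage P) (hPback : IsHalfIntegralLinkage Pback)
    (hQ : IsHalfIntegralLinkage Q) (hQback : IsHalfIntegralLinkage Qback)
    (hPdual : AreDual P Pback) (hQdual : AreDual Q Qback)
    (hcard : 24 * k ≤ P.card)
    (hd : 8 * (k : ℝ) * Real.logb (4 / 3) ((P.card : ℝ) / (24 * (k : ℝ))) + 24 * (k : ℝ) + 4
      ≤ (d : ℝ))
    (hdeg : d ≤ (intersectionGraph P Q).minDegree) :
    k ≤ directedTreewidth
      (pathUnion ((P : Set (DiPath G)) ∪ (Pback : Set (DiPath G)) ∪ (Q : Set (DiPath G)) ∪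
        (Qback : Set (DiPath G)))) := by
  have hdense : DenselyIntersecting d P Q := (denselyIntersecting_minDegree P Q).mono hdeg
  have hthreshold : degreeThreshold (8 * k : ℕ) P.card < d := by
    have hdiv : 3 * (8 * (k : ℝ)) = 24 * k := by ring
    rw [degreeThreshold, Nat.cast_mul, Nat.cast_ofNat, hdiv]
    linarith
  exact le_directedTreewidth_pathUnion (by simp [Set.finite_union]) (by grind) (by grind)
    (by grind) (by grind) hP hPback hQ hQback hPdual hQdual hdense (by omega) (by omega)
    hthreshold
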